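/- Let $s\ge 1$ be an integer, and let $T_j$ denote the Chebyshev polynomials of the first kind. Put $P_0(c)=1$ and $P_j(c)=\sqrt2\,T_j(2c-1)$ for $j\ge1$, and for $i,j=1,\dots,s$ $$c_i=\tfrac12\Bigl(1+\cos\tfrac{(2i-1)\pi}{2s}\Bigr),\qquad a_{ij}=\frac1s\sum_{\ell=0}^{s-1}P_\ell(c_j)\int_0^{c_i}P_\ell(x)\,dx,\qquad b_i=\frac1s\Bigl[1-2\sum_{j=1}^{\lceil s/2\rceil-1}\frac{\cos\frac{(2i-1)j\pi}{s}}{4j^2-1}\Bigr].$$ The $s$-stage Chebyshev collocation method CCM$(s)$ with timestep $h$, applied to $\dot y=f(y)$, $y(0)=y_0$, has the stage equations and the result $$Y_i=y_0+h\sum_{j=1}^s a_{ij}f(Y_j)\quad(i=1,\dots,s),\qquad y_1=y_0+h\sum_{i=1}^s b_i f(Y_i),$$ and it defines the polynomial approximation $$u(ch)=y_0+h\sum_{\ell=0}^{s-1}\Bigl(\int_0^cP_\ell(x)\,dx\Bigr)\hat\gamma_\ell,\qquad \hat\gamma_\ell=\frac1s\sum_{j=1}^sP_\ell(c_j)f(Y_j),\qquad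 c\in[0,1].$$ **Theorem.** Let $E$ be a finite-dimensional real normed space (that is, $\mathbb R^m$ with any norm $|\cdot|$), $D\subseteq E$ open, $f:D\to E$ real analytic, $y_0\in D$, and let $y:[0,T]\to D$, $T>0$, be a solution of $\dot y=f(y)$, $y(0)=y_0$. Let $K\subseteq D$ be any compact neighbourhood of $y_0$. Then there are $h_0\in(0,T]$ and $C$ such that for every $h\in(0,h_0]$ the stage equations of CCM$(s)$ have exactly one solution $(Y_1,\dots,Y_s)$ with all $Y_i\in K$, and for this solution $y_1=u(h)$, $$\max_{c\in[0,1]}|u(ch)-y(ch)|\le C\,h^{s+1},\qquad |y_1-y(h)|\le C\,h^{r+1},$$ where $r=s$ if $s$ is even and $r=s+1$ if $s$ is odd. -/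

import Mathlib

open Set Filter Topology

namespace CCM

noncomputable section

/-- The orthonormal shifted Chebyshev basis on `[0,1]`:
`P 0 = 1` and `P j c = √2 T_j(2c - 1)` for `j ≥ 1`. -/
def P (j : ℕ) (c : ℝ) : ℝ :=
  if j = 0 then 1 else √2 * (Polynomial.Chebyshev.T ℝ (j : ℤ)).eval (2 * c - 1)

/-- The integral `∫₀ᶜ P_j(x) dx`. -/
def intP (j : ℕ) (c : ℝ) : ℝ := ∫ x in (0 : ℝ)..c, P j x

/-- The Chebyshev abscissae `c_i = (1 + cos θ_i) / 2`, `θ_i = (2 i - 1) π / (2 s)`,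
`i = 1, …, s`. The index `i : Fin s` starts at `0`. -/
def node (s : ℕ) (i : Fin s) : ℝ :=
  (1 + Real.cos ((2 * (i : ℝ) + 1) * Real.pi / (2 * (s : ℝ)))) / 2

/-- The Butcher matrix `a_{ij} = (1/s) ∑_{ℓ < s} (∫₀^{c_i} P_ℓ(x) dx) P_ℓ(c_j)` of `CCM(s)`. -/
def butcherA (s : ℕ) (i j : Fin s) : ℝ :=
  (1 / (s : ℝ)) * ∑ l ∈ Finset.range s, intP l (node s i) * P l (node s j)

/-- The weights `b_i = (1/s) [1 - 2 ∑_{j = 1}^{⌈s/2⌉ - 1} cos((2 i - 1) j π / s) / (4 j² - 1)]`,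
`i = 1, …, s`, of `CCM(s)`. The index `i : Fin s` starts at `0`, and `⌈s/2⌉ = (s + 1) / 2` in
natural-number division. -/
def butcherB (s : ℕ) (i : Fin s) : ℝ :=
  (1 / (s : ℝ)) * (1 - 2 * ∑ j ∈ Finset.Icc 1 ((s + 1) / 2 - 1),
    Real.cos ((2 * (i : ℝ) + 1) * (j : ℝ) * Real.pi / (s : ℝ)) / (4 * (j : ℝ) ^ 2 - 1))

variable {E : Type*} [NormedAddCommGroup E] [NormedSpace ℝ E]

/-- `Y` is a solution of the stage equations of `CCM(s)` with timestep `h` for `y' = f(y)`,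
`y(0) = y₀`. -/
def IsStages (s : ℕ) (f : E → E) (y₀ : E) (h : ℝ) (Y : Fin s → E) : Prop :=
  ∀ i, Y i = y₀ + h • ∑ j, butcherA s i j • f (Y j)

/-- The approximate Fourier coefficients `γ̂_ℓ = (1/s) ∑_j P_ℓ(c_j) f(Y_j)`. -/
def gammaHat (s : ℕ) (f : E → E) (Y : Fin s → E) (l : ℕ) : E :=
  (1 / (s : ℝ)) • ∑ j, P l (node s j) • f (Y j)

/-- The polynomial approximation on `[0,h]` in the scaled variable: `approx s f y₀ h Y c` is
`u(ch) = y₀ + h ∑_{ℓ < s} (∫₀ᶜ P_ℓ(x) dx) γ̂_ℓ`, a polynomial in `c` of degree at most `s`. -/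
def approx (s : ℕ) (f : E → E) (y₀ : E) (h : ℝ) (Y : Fin s → E) (c : ℝ) : E :=
  y₀ + h • ∑ l ∈ Finset.range s, intP l c • gammaHat s f Y l

/-- The result `y₁ = y₀ + h ∑_i b_i f(Y_i)` of one step of `CCM(s)`. -/
def step (s : ℕ) (f : E → E) (y₀ : E) (h : ℝ) (Y : Fin s → E) : E :=
  y₀ + h • ∑ i, butcherB s i • f (Y i)

/-- The order of `CCM(s)`: `s` if `s` is even, `s + 1` if `s` is odd. -/
def order (s : ℕ) : ℕ := if Even s then s else s + 1

end

end CCM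

/-! Everything reduces to one family of quadrature rules: `approx` at `c` is `y₀` plus `h` times the
rule `weight s c` applied to the stage values of `f`, where this rule approximates `∫₀ᶜ`. Taking `c`
a node gives the stages, `c = 1` the step. Discrete orthogonality at the Chebyshev nodes makes the
rule exact in degree below `s` (`sum_weight_mul_pow`). It sends `P_s` to `0`, as does `∫₀¹` for odd
`s`, so one degree is gained at `c = 1` (`sum_weight_one_mul_pow_of_odd`). Exactness bounds the
defect of the true solution (`exists_defect_le`). For small `h` the stage map is a contraction on a
ball, so the stage error is at most twice the defect. That error enters the step with a further
factor `h`, so the extra degree survives as an extra order. -/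

namespace CCM

/-! ### Discrete orthogonality and the quadrature weights. -/

open Polynomial.Chebyshev in
theorem P_eq (j : ℕ) (c : ℝ) :
    P j c = (if j = 0 then 1 else √2) * (T ℝ (j : ℤ)).eval (2 * c - 1) := by
  unfold P; split_ifs with h <;> simp [h]

theorem continuous_P (j : ℕ) : Continuous (P j) := by
  have : P j = fun c => _ := funext (P_eq j)
  rw [this]; fun_prop

theorem continuous_intP (j : ℕ) : Continuous (intP j) :=
  intervalIntegral.continuous_primitive (fun _ _ => (continuous_P j).intervalIntegrable _ _) 0

theorem two_mul_node_sub_one (s : ℕ) (i : Fin s) :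
    2 * node s i - 1 = Real.cos ((2 * (i : ℝ) + 1) / (2 * (s : ℝ)) * Real.pi) := by
  unfold node; ring_nf

theorem node_mem_Icc (s : ℕ) (i : Fin s) : node s i ∈ Icc (0 : ℝ) 1 := by
  unfold node
  constructor
  · linarith [Real.neg_one_le_cos ((2 * (i : ℝ) + 1) * Real.pi / (2 * (s : ℝ)))]
  · linarith [Real.cos_le_one ((2 * (i : ℝ) + 1) * Real.pi / (2 * (s : ℝ)))]

open Polynomial.Chebyshev in
/-- The sum of `T_k` over the Chebyshev nodes. -/
theorem sum_T_node {s : ℕ} (hs : s ≠ 0) {k : ℤ} (hk : |k| < 2 * s) :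
    ∑ j : Fin s, (T ℝ k).eval (2 * node s j - 1) = if k = 0 then (s : ℝ) else 0 := by
  split_ifs with h
  · simp [h]
  · have h1 : ¬ (2 * s : ℤ) ∣ k := fun hd => h (Int.eq_zero_of_abs_lt_dvd hd hk)
    have h2 := sumZeroes_T_of_not_dvd h1
    have h3 : Real.pi / (s : ℝ) ≠ 0 := by positivity
    simp_rw [two_mul_node_sub_one]
    rw [Fin.sum_univ_eq_sum_range
      (fun i => (T ℝ k).eval (Real.cos ((2 * (i : ℝ) + 1) / (2 * (s : ℝ)) * Real.pi)))]
    exact (mul_eq_zero.mp h2).resolve_left h3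

open Polynomial.Chebyshev in
/-- Discrete orthogonality of the basis at the Chebyshev nodes. -/
theorem sum_P_mul_P {s : ℕ} {l m : ℕ} (hl : l < s) (hm : m ≤ s) :
    ∑ j : Fin s, P l (node s j) * P m (node s j) = if l = m then (s : ℝ) else 0 := by
  have hs : s ≠ 0 := by omega
  -- `2 T_l T_m = T_{l+m} + T_{l-m}`, and both indices stay below `2s` in absolute value even for `m
  -- = s`.
  have key : 2 * ∑ j : Fin s, (T ℝ (l : ℤ)).eval (2 * node s j - 1) *
      (T ℝ (m : ℤ)).eval (2 * node s j - 1) =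
      (if (l + m : ℤ) = 0 then (s : ℝ) else 0) + if (l - m : ℤ) = 0 then (s : ℝ) else 0 := by
    rw [← sum_T_node hs (k := l + m) (by rw [abs_lt]; omega),
      ← sum_T_node hs (k := l - m) (by rw [abs_lt]; omega), Finset.mul_sum,
      ← Finset.sum_add_distrib]
    refine Finset.sum_congr rfl fun j _ => ?_
    rw [← Polynomial.eval_add, ← T_mul_T]
    simp [mul_assoc]
  simp_rw [P_eq, mul_mul_mul_comm, ← Finset.mul_sum]
  by_cases h : l = m
  · subst h
    by_cases h0 : l = 0
    · subst h0; simp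
    · have : ¬ ((l : ℤ) + l = 0) := by omega
      simp only [this, sub_self, if_true, if_false, h0] at key ⊢
      rw [Real.mul_self_sqrt (by norm_num), key, zero_add]
  · rw [if_neg (by omega), if_neg (by omega)] at key
    rw [if_neg h]
    have : ∑ j : Fin s, (T ℝ (l : ℤ)).eval (2 * node s j - 1) *
      (T ℝ (m : ℤ)).eval (2 * node s j - 1) = 0 := by linarith
    rw [this, mul_zero]

/-- The weight of the `j`-th stage value in the polynomial approximation at `c`. -/
noncomputable def weight (s : ℕ) (c : ℝ) (j : Fin s) : ℝ :=
  (1 / (s : ℝ)) * ∑ l ∈ Finset.range s, intP l c * P l (node s j)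

/-- Orthogonality leaves only `ℓ = m`. The borderline `m = s` is kept for the extra order when `s`
is odd. -/
theorem sum_weight_mul_P {s : ℕ} {m : ℕ} (hm : m ≤ s) (hs : s ≠ 0) (c : ℝ) :
    ∑ j, weight s c j * P m (node s j) = if m < s then intP m c else 0 := by
  have h1 : ∑ j, weight s c j * P m (node s j) = (1 / (s : ℝ)) *
      ∑ l ∈ Finset.range s, intP l c * ∑ j, P l (node s j) * P m (node s j) := by
    simp_rw [weight, mul_assoc, ← Finset.mul_sum, Finset.sum_mul, Finset.mul_sum]
    rw [Finset.sum_comm]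
    simp_rw [mul_assoc]
  have h2 : ∀ l ∈ Finset.range s, intP l c * ∑ j, P l (node s j) * P m (node s j) =
      if l = m then intP l c * s else 0 := fun l hl => by
    rw [sum_P_mul_P (Finset.mem_range.mp hl) hm]; split_ifs <;> simp
  rw [h1, Finset.sum_congr rfl h2, Finset.sum_ite_eq']
  simp only [Finset.mem_range]
  split_ifs
  · field_simp
  · simp

/-! ### Integrals over `[0,1]` and the closed form of the weights. -/

theorem intP_zero (c : ℝ) : intP 0 c = c := by simp [intP, P]

open Polynomial.Chebyshev in
theorem intP_one_eq {m : ℕ} (hm : m ≠ 0) :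
    intP m 1 = √2 / 2 * ∫ x in (-1 : ℝ)..1, (T ℝ (m : ℤ)).eval x := by
  have h := intervalIntegral.integral_comp_mul_sub (a := 0) (b := 1)
    (fun x => (T ℝ (m : ℤ)).eval x) (two_ne_zero' ℝ) 1
  simp only [intP, P, if_neg hm, intervalIntegral.integral_const_mul]
  rw [h]
  norm_num
  ring

open Polynomial.Chebyshev in
theorem intP_one_of_odd {m : ℕ} (hm : Odd m) : intP m 1 = 0 := by
  have hm0 : m ≠ 0 := by rintro rfl; simp at hm
  have h := intervalIntegral.integral_comp_neg (a := -1) (b := 1)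
    (fun x => (T ℝ (m : ℤ)).eval x)
  simp only [T_eval_neg, Int.negOnePow_odd _ ((Int.odd_coe_nat m).mpr hm), neg_neg,
    Units.val_neg, Units.val_one, Int.cast_neg, Int.cast_one, neg_mul, one_mul,
    intervalIntegral.integral_neg] at h
  rw [intP_one_eq hm0]
  have : ∫ x in (-1 : ℝ)..1, (T ℝ (m : ℤ)).eval x = 0 := by linarith
  rw [this, mul_zero]

open Polynomial.Chebyshev in
theorem intP_one_of_even {j : ℕ} (hj : j ≠ 0) :
    intP (2 * j) 1 = - √2 / (4 * (j : ℝ) ^ 2 - 1) := by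
  rw [intP_one_eq (by omega)]
  have hj1 : (1 : ℝ) ≤ j := by exact_mod_cast Nat.one_le_iff_ne_zero.mpr hj
  have hp : (2 * (j : ℝ) + 1) ≠ 0 := by positivity
  have hm : (2 * (j : ℝ) - 1) ≠ 0 := by linarith
  -- Antiderivative of `T_n`, `n = 2j`; it follows from `T_k' = k U_{k-1}` and `2 T_n = U_n -
  -- U_{n-2}`.
  have hd : ∀ x ∈ uIcc (-1 : ℝ) 1, HasDerivAt (fun x : ℝ =>
      (T ℝ (2 * (j : ℤ) + 1)).eval x / (2 * (2 * (j : ℝ) + 1)) -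
      (T ℝ (2 * (j : ℤ) - 1)).eval x / (2 * (2 * (j : ℝ) - 1)))
      ((T ℝ ((2 * j : ℕ) : ℤ)).eval x) x := by
    intro x _
    have h1 := ((T ℝ (2 * (j : ℤ) + 1)).hasDerivAt x).div_const (2 * (2 * (j : ℝ) + 1))
    have h2 := ((T ℝ (2 * (j : ℤ) - 1)).hasDerivAt x).div_const (2 * (2 * (j : ℝ) - 1))
    refine (h1.sub h2).congr_deriv ?_
    have h3 := congrArg (Polynomial.eval x) (two_mul_T_eq_U_sub_U ℝ (2 * (j : ℤ) - 2))
    simp only [T_derivative_eq_U, Polynomial.eval_mul, Polynomial.eval_sub,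
      Polynomial.eval_ofNat, Polynomial.eval_intCast] at h3 ⊢
    push_cast
    rw [show (2 * (j : ℤ) - 2 + 2) = 2 * j by ring] at h3
    rw [show (2 * (j : ℤ) + 1 - 1) = 2 * j by ring, show (2 * (j : ℤ) - 1 - 1) = 2 * j - 2 by ring]
    field_simp
    linarith
  rw [intervalIntegral.integral_eq_sub_of_hasDerivAt hd
    ((Polynomial.continuous _).intervalIntegrable _ _)]
  have ho1 : Odd (2 * (j : ℤ) + 1) := ⟨j, rfl⟩
  have ho2 : Odd (2 * (j : ℤ) - 1) := ⟨j - 1, by ring⟩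
  simp only [T_eval_one, T_eval_neg_one, Int.negOnePow_odd _ ho1, Int.negOnePow_odd _ ho2]
  have hq : (4 * (j : ℝ) ^ 2 - 1) ≠ 0 := by
    rw [show 4 * (j : ℝ) ^ 2 - 1 = (2 * j + 1) * (2 * j - 1) by ring]; exact mul_ne_zero hp hm
  push_cast
  rw [show 4 * (j : ℝ) ^ 2 - 1 = (2 * j + 1) * (2 * j - 1) by ring] at hq ⊢
  field_simp
  ring

theorem sum_range_even {M : Type*} [AddCommMonoid M] (g : ℕ → M) (hg : ∀ l, Odd l → g l = 0)
    (s : ℕ) : ∑ l ∈ Finset.range s, g l = ∑ j ∈ Finset.range ((s + 1) / 2), g (2 * j) := by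
  induction s with
  | zero => simp
  | succ s ih =>
    rw [Finset.sum_range_succ, ih]
    rcases Nat.even_or_odd' s with ⟨k, rfl | rfl⟩
    · rw [show (2 * k + 1 + 1) / 2 = k + 1 by omega, show (2 * k + 1) / 2 = k by omega,
        Finset.sum_range_succ]
    · rw [hg _ ⟨k, rfl⟩, add_zero, show (2 * k + 1 + 1 + 1) / 2 = (2 * k + 1 + 1) / 2 by omega]

/-- At `c = 1` the odd `ℓ` drop out. For `ℓ = 2j` the factor `√2` of the integral and that of `P_ℓ`
combine to the `2` in `butcherB`. -/
theorem butcherB_eq_weight {s : ℕ} (hs : 1 ≤ s) (i : Fin s) : butcherB s i = weight s 1 i := by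
  unfold butcherB weight
  congr 1
  rw [sum_range_even (fun l => intP l 1 * P l (node s i))
    (fun l hl => by simp [intP_one_of_odd hl])]
  obtain ⟨n, hn⟩ : ∃ n, (s + 1) / 2 = n + 1 := ⟨(s + 1) / 2 - 1, by omega⟩
  rw [hn, Nat.add_sub_cancel, Finset.sum_range_succ', Finset.mul_sum]
  simp only [mul_zero, intP_zero]
  rw [show P 0 (node s i) = 1 by simp [P], one_mul, sub_eq_add_neg, add_comm (1 : ℝ), add_left_inj,
    ← Finset.sum_neg_distrib, Finset.range_eq_Ico,
    Finset.sum_Ico_add' (fun j => intP (2 * j) 1 * P (2 * j) (node s i)) 0 n 1, zero_add,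
    show Finset.Ico 1 (n + 1) = Finset.Icc 1 n from rfl]
  refine Finset.sum_congr rfl fun j hj => ?_
  have hj0 : j ≠ 0 := by have := (Finset.mem_Icc.mp hj).1; omega
  rw [intP_one_of_even hj0, P, if_neg (by omega), two_mul_node_sub_one,
    Polynomial.Chebyshev.T_real_cos]
  have h2 : √2 * √2 = 2 := Real.mul_self_sqrt (by norm_num)
  have hs0 : (s : ℝ) ≠ 0 := by positivity
  have hc : (((2 * j : ℕ) : ℤ) : ℝ) * ((2 * (i : ℝ) + 1) / (2 * (s : ℝ)) * Real.pi) =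
      (2 * (i : ℝ) + 1) * (j : ℝ) * Real.pi / (s : ℝ) := by
    push_cast; field_simp
  rw [hc, neg_div, neg_mul, div_mul_eq_mul_div, ← mul_assoc, h2, mul_div_assoc 2]

/-! ### Exactness of the rules on monomials. -/

open Polynomial Polynomial.Chebyshev in
theorem exists_pow_eq_sum_P {k n : ℕ} (hk : k < n) :
    ∃ a : ℕ → ℝ, ∀ x : ℝ, x ^ k = ∑ m ∈ Finset.range n, a m * P m x := by
  -- `x ^ k` in the variable `z = 2x - 1`, where the basis consists of multiples of `T_m z`.
  let q : ℝ[X] := (Polynomial.C (1 / 2) * (X + 1)) ^ k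
  have hq : q ∈ degreeLT ℝ n := by
    rw [mem_degreeLT]
    refine lt_of_le_of_lt (degree_le_of_natDegree_le ?_) (by exact_mod_cast hk)
    have h1 : (Polynomial.C (1 / 2 : ℝ) * (X + 1)).natDegree ≤ 1 := by compute_degree
    exact (natDegree_pow_le_of_le k h1).trans (by simp)
  rw [← Sequence.span_degreeLT (chebyshevTsequence ℝ) (by simp),
    show Set.Iio n = Finset.range n by simp,
    Submodule.mem_span_image_finset_iff_exists_fun'] at hq
  obtain ⟨a, ha⟩ := hq
  refine ⟨fun m => a m / (if m = 0 then 1 else √2), fun x => ?_⟩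
  have h := congrArg (eval (2 * x - 1)) ha
  simp only [eval_finsetSum, eval_smul, smul_eq_mul, q, eval_pow, eval_mul, eval_add, eval_X,
    eval_one, eval_C, chebyshevTsequence] at h
  rw [show (1 / 2 * (2 * x - 1 + 1)) = x by ring] at h
  rw [← h]
  refine Finset.sum_congr rfl fun m _ => ?_
  rw [P_eq]
  have : (if m = 0 then (1 : ℝ) else √2) ≠ 0 := by split_ifs <;> simp
  field_simp

/-- The rule `∑ⱼ weight s c j g(cⱼ)` for `∫₀ᶜ g` is exact on monomials of degree below `n` as soon
as it is exact on the first `n` basis functions. -/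
theorem sum_weight_mul_pow_of_P {s n : ℕ} {c : ℝ}
    (h : ∀ m < n, ∑ j, weight s c j * P m (node s j) = intP m c) {k : ℕ} (hk : k < n) :
    ∑ j, weight s c j * node s j ^ k = c ^ (k + 1) / (k + 1) := by
  obtain ⟨a, ha⟩ := exists_pow_eq_sum_P hk
  have h1 : ∫ x in (0 : ℝ)..c, x ^ k = c ^ (k + 1) / (k + 1) := by simp [integral_pow]
  rw [← h1]
  simp_rw [ha, Finset.mul_sum]
  rw [Finset.sum_comm, intervalIntegral.integral_finsetSum
    (fun m _ => ((continuous_P m).intervalIntegrable _ _).const_mul _)]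
  refine Finset.sum_congr rfl fun m hm => ?_
  rw [intervalIntegral.integral_const_mul, ← intP, ← h m (Finset.mem_range.mp hm), Finset.mul_sum]
  exact Finset.sum_congr rfl fun j _ => by ring

theorem sum_weight_mul_pow {s k : ℕ} (hk : k < s) (c : ℝ) :
    ∑ j, weight s c j * node s j ^ k = c ^ (k + 1) / (k + 1) :=
  sum_weight_mul_pow_of_P (n := s)
    (fun m hm => by rw [sum_weight_mul_P hm.le (by omega), if_pos hm]) hk

theorem sum_weight_one_mul_pow_of_odd {s k : ℕ} (hs : Odd s) (hk : k < s + 1) :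
    ∑ j, weight s 1 j * node s j ^ k = 1 ^ (k + 1) / ((k : ℝ) + 1) := by
  refine sum_weight_mul_pow_of_P (n := s + 1) (fun m hm => ?_) hk
  rw [sum_weight_mul_P (by omega) (by rintro rfl; simp at hs)]
  split_ifs with h
  · rfl
  · rw [show m = s by omega, intP_one_of_odd hs]

theorem exists_sum_abs_weight_le (s : ℕ) :
    ∃ W : ℝ, 0 < W ∧ ∀ c ∈ Icc (0 : ℝ) 1, ∑ j, |weight s c j| ≤ W := by
  have hc : Continuous fun c => ∑ j, |weight s c j| := by
    unfold weight
    have := continuous_intP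
    fun_prop
  obtain ⟨W, hW⟩ := isCompact_Icc.bddAbove_image (hc.continuousOn (s := Icc (0 : ℝ) 1))
  exact ⟨max W 1, by positivity, fun c h => (hW ⟨c, h, rfl⟩).trans (le_max_left _ _)⟩

end CCM

/-! ### Defect of the exact solution and contraction of the stage map. -/

namespace CCM

theorem norm_sub_le_of_lipschitzOnWith_closedBall {E : Type*} [NormedAddCommGroup E]
    {s : ℕ} {f : E → E} {L : NNReal} {y₀ : E}
    {R : ℝ} (hL : LipschitzOnWith L f (Metric.closedBall y₀ R)) {Y Z : Fin s → E}
    (hY : ∀ j, Y j ∈ Metric.closedBall y₀ R) (hZ : ∀ j, Z j ∈ Metric.closedBall y₀ R)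
    (j : Fin s) : ‖f (Y j) - f (Z j)‖ ≤ L * ‖Y - Z‖ :=
  (hL.norm_sub_le (hY j) (hZ j)).trans
    (mul_le_mul_of_nonneg_left (norm_le_pi_norm (Y - Z) j) L.coe_nonneg)

variable {E : Type*} [NormedAddCommGroup E] [NormedSpace ℝ E]

theorem approx_eq_sum_weight (s : ℕ) (f : E → E) (y₀ : E) (h : ℝ) (Y : Fin s → E) (c : ℝ) :
    approx s f y₀ h Y c = y₀ + h • ∑ j, weight s c j • f (Y j) := by
  unfold approx gammaHat weight
  congr 2
  simp_rw [Finset.smul_sum, smul_smul]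
  rw [Finset.sum_comm]
  refine Finset.sum_congr rfl fun j _ => ?_
  rw [← Finset.sum_smul, Finset.mul_sum]
  congr 1
  exact Finset.sum_congr rfl fun l _ => by ring

theorem isStages_iff (s : ℕ) (f : E → E) (y₀ : E) (h : ℝ) (Y : Fin s → E) :
    IsStages s f y₀ h Y ↔ ∀ i, Y i = approx s f y₀ h Y (node s i) := by
  -- `butcherA s i j` unfolds to `weight s (node s i) j`.
  simp_rw [approx_eq_sum_weight]; rfl

theorem step_eq_approx_one {s : ℕ} (hs : 1 ≤ s) (f : E → E) (y₀ : E) (h : ℝ) (Y : Fin s → E) :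
    step s f y₀ h Y = approx s f y₀ h Y 1 := by
  simp_rw [approx_eq_sum_weight, step, butcherB_eq_weight hs]

theorem norm_sum_weight_smul_le {s : ℕ} {W c B : ℝ} (hW : ∑ j, |weight s c j| ≤ W) (hB : 0 ≤ B)
    {v : Fin s → E} (hv : ∀ j, ‖v j‖ ≤ B) : ‖∑ j, weight s c j • v j‖ ≤ W * B := by
  refine (norm_sum_le _ _).trans (le_trans ?_ (mul_le_mul_of_nonneg_right hW hB))
  rw [Finset.sum_mul]
  refine Finset.sum_le_sum fun j _ => ?_
  rw [norm_smul, Real.norm_eq_abs]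
  exact mul_le_mul_of_nonneg_left (hv j) (abs_nonneg _)

/-- Taylor expansion of a derivative together with that of the function. -/
theorem exists_taylor_of_hasDerivWithinAt {T : ℝ} (hT : 0 ≤ T) {y g : ℝ → E}
    (hy : ∀ t ∈ Icc 0 T, HasDerivWithinAt y (g t) (Icc 0 T) t) {n : ℕ} (hn : n ≠ 0)
    (hg : ContDiffOn ℝ n g (Icc 0 T)) :
    ∃ (a : ℕ → E) (C : ℝ), 0 ≤ C ∧ ∀ t ∈ Icc 0 T,
      ‖g t - ∑ k ∈ Finset.range n, t ^ k • a k‖ ≤ C * t ^ n ∧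
      ‖y t - y 0 - ∑ k ∈ Finset.range n, (t ^ (k + 1) / (k + 1)) • a k‖ ≤ C * t ^ (n + 1) := by
  obtain ⟨m, rfl⟩ := Nat.exists_eq_succ_of_ne_zero hn
  obtain ⟨C, hC⟩ := exists_taylor_mean_remainder_bound hT (n := m) (by exact_mod_cast hg)
  let a : ℕ → E := fun k => ((k.factorial : ℝ)⁻¹) • iteratedDerivWithin k g (Icc 0 T) 0
  have h1 : ∀ t ∈ Icc 0 T,
      ‖g t - ∑ k ∈ Finset.range (m + 1), t ^ k • a k‖ ≤ max C 0 * t ^ (m + 1) := by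
    intro t ht
    have := hC t ht
    rw [taylor_within_apply] at this
    simp only [sub_zero] at this
    refine le_trans (le_of_eq ?_) (this.trans
      (mul_le_mul_of_nonneg_right (le_max_left C 0) (pow_nonneg ht.1 _)))
    congr 2
    exact Finset.sum_congr rfl fun k _ => by rw [smul_smul, mul_comm]
  refine ⟨a, max C 0, le_max_right _ _, fun t ht => ⟨h1 t ht, ?_⟩⟩
  -- The remainder of `y` has the remainder of `g` as derivative, so the mean value inequality on
  -- `[0,t]` gains a factor `t`.
  have hd : ∀ x ∈ Icc 0 t, HasDerivWithinAt
      (fun x => y x - ∑ k ∈ Finset.range (m + 1), (x ^ (k + 1) / ((k : ℝ) + 1)) • a k)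
      (g x - ∑ k ∈ Finset.range (m + 1), x ^ k • a k) (Icc 0 t) x := by
    intro x hx
    have hsub : Icc 0 t ⊆ Icc 0 T := Icc_subset_Icc_right ht.2
    refine ((hy x (hsub hx)).mono hsub).sub (HasDerivWithinAt.fun_sum fun k _ => ?_)
    have h2 := (((hasDerivAt_id x).pow (k + 1)).div_const ((k : ℝ) + 1)).smul_const (a k)
    refine (h2.congr_deriv ?_).hasDerivWithinAt
    have : (k : ℝ) + 1 ≠ 0 := by positivity
    congr 1
    simp
    field_simp
  have h3 := norm_image_sub_le_of_norm_deriv_le_segment' hd (C := max C 0 * t ^ (m + 1))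
    (fun x hx => (h1 x ⟨hx.1, hx.2.le.trans ht.2⟩).trans
      (mul_le_mul_of_nonneg_left (pow_le_pow_left₀ hx.1 hx.2.le _) (le_max_right _ _)))
    t ⟨ht.1, le_rfl⟩
  simp only [ne_eq, Nat.add_eq_zero_iff, one_ne_zero, and_false, not_false_eq_true, zero_pow,
    zero_div, zero_smul, Finset.sum_const_zero, sub_zero] at h3
  rw [sub_right_comm]
  refine h3.trans (le_of_eq ?_)
  rw [Nat.succ_eq_add_one]
  ring

/-- The defect of an exact solution in the collocation formula at `c` is of order `n + 1` if the
underlying rule is exact on monomials of degree below `n`. -/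
theorem exists_defect_le (s : ℕ) {T : ℝ} (hT : 0 ≤ T) {y g : ℝ → E}
    (hy : ∀ t ∈ Icc 0 T, HasDerivWithinAt y (g t) (Icc 0 T) t) {n : ℕ} (hn : n ≠ 0)
    (hg : ContDiffOn ℝ n g (Icc 0 T)) :
    ∃ C : ℝ, 0 ≤ C ∧ ∀ h ∈ Icc 0 T, ∀ c ∈ Icc (0 : ℝ) 1,
      (∀ k < n, ∑ j, weight s c j * node s j ^ k = c ^ (k + 1) / (k + 1)) →
      ‖y 0 + h • ∑ j, weight s c j • g (node s j * h) - y (c * h)‖ ≤ C * h ^ (n + 1) := by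
  obtain ⟨a, C, hC0, hC⟩ := exists_taylor_of_hasDerivWithinAt hT hy hn hg
  obtain ⟨W, hW0, hW⟩ := exists_sum_abs_weight_le s
  -- `W` accounts for the rule applied to the remainder of `g`, and `1` for the remainder of `y`;
  -- the polynomial parts cancel by exactness.
  refine ⟨C * (W + 1), by positivity, fun h hh c hc hex => ?_⟩
  have hmem : ∀ x ∈ Icc (0 : ℝ) 1, x * h ∈ Icc 0 T := fun x hx =>
    ⟨mul_nonneg hx.1 hh.1, (mul_le_of_le_one_left hh.1 hx.2).trans hh.2⟩
  have hpow : ∀ x ∈ Icc (0 : ℝ) 1, ∀ k : ℕ, C * (x * h) ^ k ≤ C * h ^ k := fun x hx k =>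
    mul_le_mul_of_nonneg_left
      (pow_le_pow_left₀ (hmem x hx).1 (mul_le_of_le_one_left hh.1 hx.2) _) hC0
  have hq : h • ∑ j, weight s c j • ∑ k ∈ Finset.range n, (node s j * h) ^ k • a k =
      ∑ k ∈ Finset.range n, ((c * h) ^ (k + 1) / ((k : ℝ) + 1)) • a k := by
    simp_rw [Finset.smul_sum, smul_smul]
    rw [Finset.sum_comm]
    refine Finset.sum_congr rfl fun k hk => ?_
    rw [← Finset.sum_smul]
    congr 1
    calc ∑ j, h * (weight s c j * (node s j * h) ^ k)
        = h ^ (k + 1) * ∑ j, weight s c j * node s j ^ k := by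
          rw [Finset.mul_sum]
          exact Finset.sum_congr rfl fun j _ => by rw [mul_pow]; ring
      _ = _ := by rw [hex k (Finset.mem_range.mp hk), mul_pow]; ring
  have hsplit : y 0 + h • ∑ j, weight s c j • g (node s j * h) - y (c * h) =
      h • ∑ j, weight s c j • (g (node s j * h) - ∑ k ∈ Finset.range n, (node s j * h) ^ k • a k)
      - (y (c * h) - y 0 - ∑ k ∈ Finset.range n, ((c * h) ^ (k + 1) / ((k : ℝ) + 1)) • a k) := by
    simp_rw [smul_sub, Finset.sum_sub_distrib]
    rw [smul_sub, hq]
    abel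
  rw [hsplit]
  have h1 := norm_sum_weight_smul_le (hW c hc) (B := C * h ^ n)
    (mul_nonneg hC0 (pow_nonneg hh.1 _)) (fun j =>
      (hC _ (hmem _ (node_mem_Icc s j))).1.trans (hpow _ (node_mem_Icc s j) n))
  have h2 := (hC _ (hmem c hc)).2.trans (hpow c hc (n + 1))
  refine (norm_sub_le _ _).trans ((add_le_add (?_ : _ ≤ h * (W * (C * h ^ n))) h2).trans
    (le_of_eq (by ring)))
  rw [norm_smul, Real.norm_of_nonneg hh.1]
  exact mul_le_mul_of_nonneg_left h1 hh.1

theorem norm_approx_sub_le {s : ℕ} {W B c h : ℝ} (hW : ∑ j, |weight s c j| ≤ W) (hB : 0 ≤ B)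
    (hh : 0 ≤ h) (f : E → E) (y₀ : E) {Y Z : Fin s → E} (hYZ : ∀ j, ‖f (Y j) - f (Z j)‖ ≤ B) :
    ‖approx s f y₀ h Y c - approx s f y₀ h Z c‖ ≤ h * W * B := by
  rw [approx_eq_sum_weight, approx_eq_sum_weight, add_sub_add_left_eq_sub, ← smul_sub,
    ← Finset.sum_sub_distrib, norm_smul, Real.norm_of_nonneg hh, mul_assoc]
  simp_rw [← smul_sub]
  exact mul_le_mul_of_nonneg_left (norm_sum_weight_smul_le hW hB hYZ) hh

theorem norm_approx_sub_initial_le {s : ℕ} {W M c h : ℝ} (hW : ∑ j, |weight s c j| ≤ W)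
    (hM : 0 ≤ M) (hh : 0 ≤ h) (f : E → E) (y₀ : E) {Y : Fin s → E} (hY : ∀ j, ‖f (Y j)‖ ≤ M) :
    ‖approx s f y₀ h Y c - y₀‖ ≤ h * W * M := by
  rw [approx_eq_sum_weight, add_sub_cancel_left, norm_smul, Real.norm_of_nonneg hh, mul_assoc]
  exact mul_le_mul_of_nonneg_left (norm_sum_weight_smul_le hW hM hY) hh

/-- Existence of stages in a small ball by contraction. -/
theorem exists_isStages [CompleteSpace E] {s : ℕ} {f : E → E} {L : NNReal} {y₀ : E} {R W M h : ℝ}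
    (hR : 0 ≤ R) (hW : ∀ c ∈ Icc (0 : ℝ) 1, ∑ j, |weight s c j| ≤ W) (hM : 0 ≤ M) (hh : 0 ≤ h)
    (hL : LipschitzOnWith L f (Metric.closedBall y₀ R))
    (hfM : ∀ x ∈ Metric.closedBall y₀ R, ‖f x‖ ≤ M) (h1 : h * W * M ≤ R)
    (h2 : h * W * L ≤ 1 / 2) :
    ∃ Y : Fin s → E, (∀ i, Y i ∈ Metric.closedBall y₀ R) ∧ IsStages s f y₀ h Y := by
  let Φ : (Fin s → E) → Fin s → E := fun Y i => approx s f y₀ h Y (node s i)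
  let B : Set (Fin s → E) := Metric.closedBall (fun _ => y₀) R
  have hmem : ∀ Y : Fin s → E, Y ∈ B ↔ ∀ i, Y i ∈ Metric.closedBall y₀ R := fun Y => by
    simp only [B, Metric.mem_closedBall, dist_pi_le_iff hR]
  have hmaps : MapsTo Φ B B := fun Y hY => by
    rw [hmem] at hY ⊢
    intro i
    rw [mem_closedBall_iff_norm]
    exact (norm_approx_sub_initial_le (hW _ (node_mem_Icc s i)) hM hh f y₀
      fun j => hfM _ (hY j)).trans h1
  have hlip : LipschitzOnWith (1 / 2) Φ B := LipschitzOnWith.of_dist_le_mul fun Y hY Z hZ => by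
    rw [hmem] at hY hZ
    rw [dist_eq_norm, dist_eq_norm, pi_norm_le_iff_of_nonneg (by positivity)]
    intro i
    refine (norm_approx_sub_le (hW _ (node_mem_Icc s i)) (by positivity) hh f y₀
      (norm_sub_le_of_lipschitzOnWith_closedBall hL hY hZ)).trans ?_
    rw [← mul_assoc]
    refine mul_le_mul_of_nonneg_right (h2.trans (le_of_eq (by simp))) (norm_nonneg _)
  have hcontr : ContractingWith (1 / 2) (hmaps.restrict Φ B B) :=
    ⟨by rw [← NNReal.coe_lt_coe]; norm_num, hlip.mapsToRestrict hmaps⟩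
  obtain ⟨Y, hYB, hY, -⟩ := hcontr.exists_fixedPoint' (Metric.isClosed_closedBall.isComplete)
    hmaps (x := fun _ => y₀) (Metric.mem_closedBall_self hR) (edist_ne_top _ _)
  exact ⟨Y, (hmem Y).mp hYB, (isStages_iff s f y₀ h Y).mpr fun i => (congrFun hY i).symm⟩

end CCM

/-! ### Existence, uniqueness and order of convergence. -/

theorem mainTheorem1 {E : Type*} [NormedAddCommGroup E] [NormedSpace ℝ E] [FiniteDimensional ℝ E]
    (s : ℕ) (hs : 1 ≤ s)
    (D : Set E) (hD : IsOpen D) (f : E → E) (hf : AnalyticOnNhd ℝ f D)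
    (y₀ : E) (hy₀ : y₀ ∈ D)
    (T : ℝ) (hT : 0 < T) (y : ℝ → E) (hy0 : y 0 = y₀)
    (hyD : ∀ t ∈ Icc 0 T, y t ∈ D) (hy : IsIntegralCurveOn y (fun _ => f) (Icc 0 T))
    (K : Set E) (hK : IsCompact K) (hKD : K ⊆ D) (hKy : K ∈ 𝓝 y₀) :
    ∃ h₀ : ℝ, 0 < h₀ ∧ h₀ ≤ T ∧ ∃ C : ℝ, ∀ h : ℝ, 0 < h → h ≤ h₀ →
      (∃! Y : Fin s → E, (∀ i, Y i ∈ K) ∧ CCM.IsStages s f y₀ h Y) ∧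
      ∀ Y : Fin s → E, (∀ i, Y i ∈ K) → CCM.IsStages s f y₀ h Y →
        (∀ c ∈ Icc (0 : ℝ) 1, ‖CCM.approx s f y₀ h Y c - y (c * h)‖ ≤ C * h ^ (s + 1)) ∧
        CCM.step s f y₀ h Y = CCM.approx s f y₀ h Y 1 ∧
        ‖CCM.step s f y₀ h Y - y h‖ ≤ C * h ^ (CCM.order s + 1) := by
  have : CompleteSpace E := FiniteDimensional.complete ℝ E
  have hfD : ContDiffOn ℝ ((⊤ : ℕ∞) : WithTop ℕ∞) f D := hf.contDiffOn hD.uniqueDiffOn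
  have hyC : ContDiffOn ℝ ((⊤ : ℕ∞) : WithTop ℕ∞) y (Icc 0 T) :=
    ODE.contDiffOn_enat_Icc_of_hasDerivWithinAt (f := fun _ => f) (u := D)
      (hfD.comp contDiff_snd.contDiffOn fun p hp => hp.2) hy hyD
  have hg : ContDiffOn ℝ ((⊤ : ℕ∞) : WithTop ℕ∞) (fun t => f (y t)) (Icc 0 T) :=
    hfD.comp hyC hyD
  obtain ⟨C₁, hC₁, hdef₁⟩ := CCM.exists_defect_le s hT.le hy (n := s) (by omega)
    (hg.of_le (by exact_mod_cast le_top))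
  -- Exactness is required separately at each `c`, so `n = s + 1` can be used at `c = 1` alone.
  obtain ⟨C₂, hC₂, hdef₂⟩ := CCM.exists_defect_le s hT.le hy (n := s + 1) (by omega)
    (hg.of_le (by exact_mod_cast le_top))
  obtain ⟨W, hW0, hW⟩ := CCM.exists_sum_abs_weight_le s
  obtain ⟨L, V, hV, hLV⟩ := ((hf y₀ hy₀).contDiffAt (n := 1)).exists_lipschitzOnWith
  obtain ⟨R, hR, hRVK⟩ := Metric.nhds_basis_closedBall.mem_iff.mp (inter_mem hV hKy)
  have hL := hLV.mono (hRVK.trans inter_subset_left)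
  have hBK : Metric.closedBall y₀ R ⊆ K := hRVK.trans inter_subset_right
  obtain ⟨M, hM⟩ := hK.exists_bound_of_continuousOn (hf.continuousOn.mono hKD)
  have hM0 : 0 ≤ M := (norm_nonneg _).trans (hM y₀ (mem_of_mem_nhds hKy))
  have hycont : ContinuousWithinAt y (Icc 0 T) 0 := (hy 0 ⟨le_rfl, hT.le⟩).continuousWithinAt
  obtain ⟨δ, hδ, hyδ⟩ := Metric.continuousWithinAt_iff.mp hycont R hR
  have hsmall : ∀ a b : ℝ, 0 < b → ∃ ε > 0, ∀ h, 0 < h → h ≤ ε → h * a ≤ b := fun a b hb => by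
    refine ⟨b / (|a| + 1), by positivity, fun h h0 hh => ?_⟩
    rw [le_div_iff₀ (by positivity)] at hh
    nlinarith [le_abs_self a]
  obtain ⟨ε₁, hε₁, h1⟩ := hsmall (W * M) R hR
  obtain ⟨ε₂, hε₂, h2⟩ := hsmall (W * L) (1 / 2) (by norm_num)
  -- `δ / 2` keeps the exact solution in the ball, `ε₁` makes the stage map preserve it, `ε₂` gives
  -- the contraction factor `1/2`.
  refine ⟨min (min T (δ / 2)) (min ε₁ ε₂), by positivity,
    (min_le_left _ _).trans (min_le_left _ _), 2 * C₁ + 2 * W * L * C₁ + C₂, fun h h0 hh => ?_⟩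
  simp only [le_min_iff] at hh
  obtain ⟨⟨hhT, hhδ⟩, hhε₁, hhε₂⟩ := hh
  replace h1 : h * W * M ≤ R := by rw [mul_assoc]; exact h1 h h0 hhε₁
  replace h2 : h * W * L ≤ 1 / 2 := by rw [mul_assoc]; exact h2 h h0 hhε₂
  -- `M` bounds `f` on all of `K`, so stages in `K` already lie in the small ball where `f` is
  -- Lipschitz. Hence uniqueness holds in `K`, not only in the ball.
  have hball : ∀ Y : Fin s → E, (∀ i, Y i ∈ K) → CCM.IsStages s f y₀ h Y →
      ∀ i, Y i ∈ Metric.closedBall y₀ R := fun Y hYK hY i => by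
    rw [mem_closedBall_iff_norm, (CCM.isStages_iff s f y₀ h Y).mp hY i]
    exact (CCM.norm_approx_sub_initial_le (hW _ (CCM.node_mem_Icc s i)) hM0 h0.le f y₀
      fun j => hM _ (hYK j)).trans h1
  have hcontr : ∀ Y Z : Fin s → E, (∀ i, Y i ∈ Metric.closedBall y₀ R) →
      (∀ i, Z i ∈ Metric.closedBall y₀ R) → ∀ c ∈ Icc (0 : ℝ) 1,
      ‖CCM.approx s f y₀ h Y c - CCM.approx s f y₀ h Z c‖ ≤ h * W * L * ‖Y - Z‖ :=
    fun Y Z hY hZ c hc => (CCM.norm_approx_sub_le (hW c hc) (by positivity) h0.le f y₀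
      (CCM.norm_sub_le_of_lipschitzOnWith_closedBall hL hY hZ)).trans (le_of_eq (by ring))
  refine ⟨?_, fun Y hYK hY => ?_⟩
  · obtain ⟨Y, hYB, hY⟩ := CCM.exists_isStages hR.le hW hM0 h0.le hL
      (fun x hx => hM x (hBK hx)) h1 h2
    refine ⟨Y, ⟨fun i => hBK (hYB i), hY⟩, fun Z hZ => ?_⟩
    have hle : ‖Z - Y‖ ≤ h * W * L * ‖Z - Y‖ := by
      refine (pi_norm_le_iff_of_nonneg (by positivity)).mpr fun i => ?_
      rw [Pi.sub_apply, (CCM.isStages_iff s f y₀ h Z).mp hZ.2 i,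
        (CCM.isStages_iff s f y₀ h Y).mp hY i]
      exact hcontr Z Y (hball Z hZ.1 hZ.2) hYB _ (CCM.node_mem_Icc s i)
    have := mul_le_mul_of_nonneg_right h2 (norm_nonneg (Z - Y))
    exact sub_eq_zero.mp (norm_le_zero_iff.mp (by linarith))
  · have hYB := hball Y hYK hY
    -- The exact solution at the nodes is an approximate fixed point of the stage map.
    let Z : Fin s → E := fun j => y (CCM.node s j * h)
    have hZB : ∀ j, Z j ∈ Metric.closedBall y₀ R := fun j => by
      obtain ⟨hn0, hn1⟩ := CCM.node_mem_Icc s j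
      have hle : CCM.node s j * h ≤ h := mul_le_of_le_one_left h0.le hn1
      have hnn : 0 ≤ CCM.node s j * h := mul_nonneg hn0 h0.le
      rw [← hy0]
      refine (hyδ ⟨hnn, hle.trans hhT⟩ ?_).le
      rw [Real.dist_eq, sub_zero, abs_of_nonneg hnn]
      linarith
    have hsplit : ∀ c ∈ Icc (0 : ℝ) 1, ∀ B : ℝ, ‖CCM.approx s f y₀ h Z c - y (c * h)‖ ≤ B →
        ‖CCM.approx s f y₀ h Y c - y (c * h)‖ ≤ h * W * L * ‖Y - Z‖ + B := fun c hc B hB =>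
      (norm_sub_le_norm_sub_add_norm_sub _ _ _).trans (add_le_add (hcontr Y Z hYB hZB c hc) hB)
    have hZ₁ : ∀ c ∈ Icc (0 : ℝ) 1,
        ‖CCM.approx s f y₀ h Z c - y (c * h)‖ ≤ C₁ * h ^ (s + 1) := fun c hc => by
      rw [CCM.approx_eq_sum_weight, ← hy0]
      exact hdef₁ h ⟨h0.le, hhT⟩ c hc fun k hk => CCM.sum_weight_mul_pow hk c
    have hYZ : ‖Y - Z‖ ≤ 2 * C₁ * h ^ (s + 1) := by
      have hle : ‖Y - Z‖ ≤ h * W * L * ‖Y - Z‖ + C₁ * h ^ (s + 1) := by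
        refine (pi_norm_le_iff_of_nonneg (by positivity)).mpr fun i => ?_
        rw [Pi.sub_apply, (CCM.isStages_iff s f y₀ h Y).mp hY i]
        exact hsplit _ (CCM.node_mem_Icc s i) _ (hZ₁ _ (CCM.node_mem_Icc s i))
      -- Absorbing `‖Y - Z‖ / 2` on the left produces the constant `2 * C₁`.
      have := mul_le_mul_of_nonneg_right h2 (norm_nonneg (Y - Z))
      linarith
    have hmain : ∀ c ∈ Icc (0 : ℝ) 1, ‖CCM.approx s f y₀ h Y c - y (c * h)‖ ≤
        (2 * C₁ + 2 * W * L * C₁ + C₂) * h ^ (s + 1) := fun c hc => by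
      have h3 := mul_le_mul h2 hYZ (norm_nonneg _) (by norm_num)
      have h4 := hsplit c hc _ (hZ₁ c hc)
      have h5 : 0 ≤ (2 * W * L * C₁ + C₂) * h ^ (s + 1) := by positivity
      linarith
    refine ⟨hmain, CCM.step_eq_approx_one hs f y₀ h Y, ?_⟩
    rw [CCM.step_eq_approx_one hs]
    unfold CCM.order
    split_ifs with hev
    · simpa using hmain 1 ⟨zero_le_one, le_rfl⟩
    · have hZ₂ : ‖CCM.approx s f y₀ h Z 1 - y (1 * h)‖ ≤ C₂ * h ^ (s + 1 + 1) := by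
        rw [CCM.approx_eq_sum_weight, ← hy0]
        exact hdef₂ h ⟨h0.le, hhT⟩ 1 ⟨zero_le_one, le_rfl⟩ fun k hk =>
          CCM.sum_weight_one_mul_pow_of_odd (Nat.not_even_iff_odd.mp hev) hk
      have h3 := hsplit 1 ⟨zero_le_one, le_rfl⟩ _ hZ₂
      -- Here the factor `h` is kept instead of using `h * W * L ≤ 1 / 2`; it supplies the missing
      -- power.
      have h4 : h * W * L * ‖Y - Z‖ ≤ h * W * L * (2 * C₁ * h ^ (s + 1)) :=
        mul_le_mul_of_nonneg_left hYZ (by positivity)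
      have h5 : h * W * L * (2 * C₁ * h ^ (s + 1)) = 2 * W * L * C₁ * h ^ (s + 1 + 1) := by ring
      have h6 : 0 ≤ 2 * C₁ * h ^ (s + 1 + 1) := by positivity
      rw [one_mul] at h3
      linarith
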